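/- **Setting.** Manifolds are smooth, finite-dimensional, without boundary (Hausdorffness, second countability and properness of the groupoids are not needed). Let $G\rightrightarrows M$ be a Lie groupoid with source and target $s,t:G\to M$ (submersions). A smooth 1-form $\omega$ on $M$ is *basic* if $s^*\omega=t^*\omega$. The orbit of $x$ is $\mathcal O_x=\{t(g): s(g)=x\}$, and $T_y\mathcal O_x=dt(\ker d_{1_y}s)$ for $y\in\mathcal O_x$. Let $\omega$ be a closed basic 1-form. If $\omega_x=0$, then $\mathcal O_x$ is a *critical orbit* of $\omega$; it is *nondegenerate* if there are an open set $U\supseteq\mathcal O_x$ and a smooth function $f:U\to\mathbb R$, basic for $G|_U$ (i.e. $f(s(g))=f(t(g))$ whenever $s(g),t(g)\in U$), such that $\omega|_U=df$ and $f$ is nondegenerate along $\mathcal O_x$ in the sense of Bott: $\ker \mathrm{Hess}_y f=T_y\mathcal O_x$ for every $y\in\mathcal O_x$. The form $\omega$ is *Morse* if all its critical orbits are nondegenerate. Lie groupoids $G\rightrightarrows M$ and $G'\rightrightarrows M'$ are *Morita equivalent* if there is a principal bibundle between them: a manifold $P$ with surjective submersions $a_l:P\to M$ and $a_r:P\to M'$,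 and commuting smooth actions of $G$ on the left along $a_l$ and of $G'$ on the right along $a_r$, such that $a_r$ is $G$-invariant, $a_l$ is $G'$-invariant, and the maps $G\times_M P\to P\times_{M'}P$, $(g,p)\mapsto(gp,p)$, and $P\times_{M'}G'\to P\times_M P$, $(p,h)\mapsto(p,ph)$, are diffeomorphisms. **Proposition.** Let $G\rightrightarrows M$ and $G'\rightrightarrows M'$ be Lie groupoids. 1. If $G$ and $G'$ are Morita equivalent and $G'$ admits a Morse closed basic 1-form, then so does $G$. 2. More precisely, let $P$ be a principal bibundle between $G$ and $G'$ with anchors $a_l:P\to M$, $a_r:P\to M'$, and let $\omega'$ be a Morse closed basic 1-form on $G'$. Then there is a unique smooth 1-form $\omega$ on $M$ with $a_l^*\omega=a_r^*\omega'$; it is closed, basic and Morse. Moreover $a_l^{-1}(\mathcal O_{a_l(p)})=a_r^{-1}(\mathcal O'_{a_r(p)})$ for every $p\in P$, so that $\mathcal O_{a_l(p)}\leftrightarrow\mathcal O'_{a_r(p)}$ is a bijection between the orbits of $G$ and those of $G'$; under it the critical orbits of $\omega$ correspond to the critical orbits of $\omega'$, and the nondegenerate critical orbits of $\omega$ to those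 of $\omega'$. -/

import Mathlib

open scoped Manifold ContDiff

universe w u₁ u₂ u₃ u₄

noncomputable section

/-- The model space of `n`-dimensional manifolds. -/
abbrev Eucl (n : ℕ) : Type := EuclideanSpace ℝ (Fin n)

/-! ### Lie groupoids -/

/-- A Lie groupoid `G ⇉ M`, with `M` an `n`-dimensional and `G` a `d`-dimensional smooth manifold.
The product `mul g h` (first `h`, then `g`) is meaningful only for composable pairs, that is for
`src g = tgt h`; outside of the set of composable pairs its values are arbitrary and never used.
Since `src` and `tgt` are submersions, the set of composable pairs is an embedded submanifold of
`G × G`, and `ContMDiffOn` is smoothness on it. -/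
structure LieGroupoid (n d : ℕ) (M G : Type*)
    [TopologicalSpace M] [ChartedSpace (Eucl n) M] [IsManifold (𝓡 n) ∞ M]
    [TopologicalSpace G] [ChartedSpace (Eucl d) G] [IsManifold (𝓡 d) ∞ G] where
  src : G → M
  tgt : G → M
  unit : M → G
  inv : G → G
  mul : G → G → G
  src_unit : ∀ x, src (unit x) = x
  tgt_unit : ∀ x, tgt (unit x) = x
  src_inv : ∀ g, src (inv g) = tgt g
  tgt_inv : ∀ g, tgt (inv g) = src g
  src_mul : ∀ g h, src g = tgt h → src (mul g h) = src h
  tgt_mul : ∀ g h, src g = tgt h → tgt (mul g h) = tgt g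
  mul_assoc : ∀ g h k, src g = tgt h → src h = tgt k → mul (mul g h) k = mul g (mul h k)
  unit_mul : ∀ g, mul (unit (tgt g)) g = g
  mul_unit : ∀ g, mul g (unit (src g)) = g
  inv_mul : ∀ g, mul (inv g) g = unit (src g)
  mul_inv : ∀ g, mul g (inv g) = unit (tgt g)
  src_submersion : Manifold.IsSubmersion (𝓡 d) (𝓡 n) ∞ src
  tgt_submersion : Manifold.IsSubmersion (𝓡 d) (𝓡 n) ∞ tgt
  unit_smooth : ContMDiff (𝓡 n) (𝓡 d) ∞ unit
  inv_smooth : ContMDiff (𝓡 d) (𝓡 d) ∞ inv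
  mul_smooth : ContMDiffOn ((𝓡 d).prod (𝓡 d)) (𝓡 d) ∞ (fun q : G × G => mul q.1 q.2)
    {q : G × G | src q.1 = tgt q.2}

/-! ### Principal bibundles and Morita equivalence -/

/-- A principal bibundle `P` between `𝒢 = (G ⇉ M)` and `𝒢' = (G' ⇉ M')`: a smooth manifold with
surjective submersions `left : P → M` and `right : P → M'` (the anchors), a smooth left action of
`G` along `left` and a smooth right action of `G'` along `right`. The actions commute, each of them
preserves the anchor of the other, and both are principal: `(g, p) ↦ (g p, p)` is a diffeomorphism
from `G ×_M P` onto `P ×_{M'} P`, and `(p, h) ↦ (p, p h)` is a diffeomorphism from `P ×_{M'} G'`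
onto `P ×_M P`. As for Lie groupoids, `lact g p` is meaningful only if `src g = left p`, and
`ract p h` only if `right p = tgt h`. -/
structure PrincipalBibundle {n d n' d' : ℕ} {M G M' G' : Type*}
    [TopologicalSpace M] [ChartedSpace (Eucl n) M] [IsManifold (𝓡 n) ∞ M]
    [TopologicalSpace G] [ChartedSpace (Eucl d) G] [IsManifold (𝓡 d) ∞ G]
    [TopologicalSpace M'] [ChartedSpace (Eucl n') M'] [IsManifold (𝓡 n') ∞ M']
    [TopologicalSpace G'] [ChartedSpace (Eucl d') G'] [IsManifold (𝓡 d') ∞ G']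
    (𝒢 : LieGroupoid n d M G) (𝒢' : LieGroupoid n' d' M' G')
    (k : ℕ) (P : Type*)
    [TopologicalSpace P] [ChartedSpace (Eucl k) P] [IsManifold (𝓡 k) ∞ P] where
  left : P → M
  right : P → M'
  left_submersion : Manifold.IsSubmersion (𝓡 k) (𝓡 n) ∞ left
  left_surjective : Function.Surjective left
  right_submersion : Manifold.IsSubmersion (𝓡 k) (𝓡 n') ∞ right
  right_surjective : Function.Surjective right
  lact : G → P → P
  ract : P → G' → P
  lact_smooth : ContMDiffOn ((𝓡 d).prod (𝓡 k)) (𝓡 k) ∞ (fun q : G × P => lact q.1 q.2)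
    {q : G × P | 𝒢.src q.1 = left q.2}
  ract_smooth : ContMDiffOn ((𝓡 k).prod (𝓡 d')) (𝓡 k) ∞ (fun q : P × G' => ract q.1 q.2)
    {q : P × G' | right q.1 = 𝒢'.tgt q.2}
  left_lact : ∀ g p, 𝒢.src g = left p → left (lact g p) = 𝒢.tgt g
  right_lact : ∀ g p, 𝒢.src g = left p → right (lact g p) = right p
  unit_lact : ∀ p, lact (𝒢.unit (left p)) p = p
  mul_lact : ∀ g h p, 𝒢.src g = 𝒢.tgt h → 𝒢.src h = left p →
    lact (𝒢.mul g h) p = lact g (lact h p)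
  right_ract : ∀ p h, right p = 𝒢'.tgt h → right (ract p h) = 𝒢'.src h
  left_ract : ∀ p h, right p = 𝒢'.tgt h → left (ract p h) = left p
  ract_unit : ∀ p, ract p (𝒢'.unit (right p)) = p
  ract_mul : ∀ p g h, right p = 𝒢'.tgt g → 𝒢'.src g = 𝒢'.tgt h →
    ract p (𝒢'.mul g h) = ract (ract p g) h
  lact_ract : ∀ g p h, 𝒢.src g = left p → right p = 𝒢'.tgt h →
    lact g (ract p h) = ract (lact g p) h
  left_principal : ∃ δ : P → P → G,
    ContMDiffOn ((𝓡 k).prod (𝓡 k)) (𝓡 d) ∞ (fun q : P × P => δ q.1 q.2)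
      {q : P × P | right q.1 = right q.2} ∧
    (∀ p q, right p = right q → 𝒢.src (δ p q) = left q ∧ lact (δ p q) q = p) ∧
    (∀ g q, 𝒢.src g = left q → δ (lact g q) q = g)
  right_principal : ∃ δ : P → P → G',
    ContMDiffOn ((𝓡 k).prod (𝓡 k)) (𝓡 d') ∞ (fun q : P × P => δ q.1 q.2)
      {q : P × P | left q.1 = left q.2} ∧
    (∀ p q, left p = left q → right p = 𝒢'.tgt (δ p q) ∧ ract p (δ p q) = q) ∧
    (∀ p h, right p = 𝒢'.tgt h → δ p (ract p h) = h)

/-- Two Lie groupoids are Morita equivalent if there is a principal bibundle between them. -/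
def MoritaEquivalent {n d n' d' : ℕ}
    {M : Type u₁} {G : Type u₂} {M' : Type u₃} {G' : Type u₄}
    [TopologicalSpace M] [ChartedSpace (Eucl n) M] [IsManifold (𝓡 n) ∞ M]
    [TopologicalSpace G] [ChartedSpace (Eucl d) G] [IsManifold (𝓡 d) ∞ G]
    [TopologicalSpace M'] [ChartedSpace (Eucl n') M'] [IsManifold (𝓡 n') ∞ M']
    [TopologicalSpace G'] [ChartedSpace (Eucl d') G'] [IsManifold (𝓡 d') ∞ G']
    (𝒢 : LieGroupoid n d M G) (𝒢' : LieGroupoid n' d' M' G') : Prop :=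
  ∃ (k : ℕ) (P : Type w) (_ : TopologicalSpace P) (_ : ChartedSpace (Eucl k) P)
    (_ : IsManifold (𝓡 k) ∞ P), Nonempty (PrincipalBibundle 𝒢 𝒢' k P)

/-! ### Differential 1-forms -/

/-- Smooth 1-forms on `M`: smooth sections of the cotangent bundle. -/
abbrev OneForm (n : ℕ) (M : Type*)
    [TopologicalSpace M] [ChartedSpace (Eucl n) M] [IsManifold (𝓡 n) ∞ M] :=
  Cₛ^∞⟮𝓡 n; Eucl n →L[ℝ] ℝ, fun x : M => TangentSpace (𝓡 n) x →L[ℝ] ℝ⟯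

namespace OneForm

variable {n : ℕ} {M : Type*}
    [TopologicalSpace M] [ChartedSpace (Eucl n) M] [IsManifold (𝓡 n) ∞ M]

/-- The expression of `α` in the chart around `x₀`: the pullback of `α` along the inverse of the
chart (meaningful on the target of the chart). -/
def inChart (α : OneForm n M) (x₀ : M) (z : Eucl n) : Eucl n →L[ℝ] ℝ :=
  (α ((extChartAt (𝓡 n) x₀).symm z)).comp
    (mfderiv 𝓘(ℝ, Eucl n) (𝓡 n) (extChartAt (𝓡 n) x₀).symm z)

/-- `dα = 0`: in every chart of the atlas given by the charts around the points of `M`, the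
exterior derivative of the expression of `α` vanishes. -/
def IsClosedForm (α : OneForm n M) : Prop :=
  ∀ x₀ : M, ∀ z ∈ (extChartAt (𝓡 n) x₀).target,
    extDeriv (fun y => ContinuousAlternatingMap.ofSubsingleton ℝ (Eucl n) ℝ (0 : Fin 1)
      (α.inChart x₀ y)) z = 0

/-- The pullback of the 1-form `α` along the map `a : N → M`, at the point `p`. -/
def pullbackAt (k : ℕ) {N : Type*} [TopologicalSpace N] [ChartedSpace (Eucl k) N]
    (a : N → M) (α : OneForm n M) (p : N) : TangentSpace (𝓡 k) p →L[ℝ] ℝ :=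
  (α (a p)).comp (mfderiv (𝓡 k) (𝓡 n) a p)

end OneForm

/-- The Hessian of `f : M → ℝ` at `y`, as a bilinear form on `T_y M`, computed in the preferred chart
at `y`, in which `T_y M` is identified with the model space. At a critical point of `f`, the only
case in which it is used, this is the intrinsic Hessian of `f`. -/
def hessianAt {n : ℕ} {M : Type*} [TopologicalSpace M] [ChartedSpace (Eucl n) M]
    (f : M → ℝ) (y : M) : TangentSpace (𝓡 n) y →L[ℝ] TangentSpace (𝓡 n) y →L[ℝ] ℝ :=
  (fderiv ℝ (fderiv ℝ (f ∘ (extChartAt (𝓡 n) y).symm)) (extChartAt (𝓡 n) y y) :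
    Eucl n →L[ℝ] Eucl n →L[ℝ] ℝ)

namespace LieGroupoid

variable {n d : ℕ} {M G : Type*}
    [TopologicalSpace M] [ChartedSpace (Eucl n) M] [IsManifold (𝓡 n) ∞ M]
    [TopologicalSpace G] [ChartedSpace (Eucl d) G] [IsManifold (𝓡 d) ∞ G]

/-- The orbit of `G ⇉ M` through `x`. -/
def orbit (𝒢 : LieGroupoid n d M G) (x : M) : Set M :=
  {y | ∃ g, 𝒢.src g = x ∧ 𝒢.tgt g = y}

/-- The tangent space at `y` of the orbit through `y`: the image of the anchor
`ρ_y = d(tgt) : ker (d(src) at 1_y) → T_y M` of the Lie algebroid. -/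
def orbitTangent (𝒢 : LieGroupoid n d M G) (y : M) : Set (TangentSpace (𝓡 n) y) :=
  {v | ∃ w : TangentSpace (𝓡 d) (𝒢.unit y),
    mfderiv (𝓡 d) (𝓡 n) 𝒢.src (𝒢.unit y) w = 0 ∧
    tangentMap (𝓡 d) (𝓡 n) 𝒢.tgt ⟨𝒢.unit y, w⟩ = (⟨y, v⟩ : TangentBundle (𝓡 n) M)}

/-- A 1-form `α` on `M` is basic if `src^* α = tgt^* α`. -/
def IsBasic (𝒢 : LieGroupoid n d M G) (α : OneForm n M) : Prop :=
  ∀ g : G, α.pullbackAt d 𝒢.src g = α.pullbackAt d 𝒢.tgt g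

/-- The function `f` is basic on `U`, that is, invariant under the restricted groupoid `G|_U`. -/
def IsBasicOn (𝒢 : LieGroupoid n d M G) (f : M → ℝ) (U : Set M) : Prop :=
  ∀ g : G, 𝒢.src g ∈ U → 𝒢.tgt g ∈ U → f (𝒢.src g) = f (𝒢.tgt g)

/-- The orbit `O` through `x` is a nondegenerate critical orbit of `α`: `α` vanishes at `x`, and on
an open neighbourhood `U` of `O` one has `α = df` for a smooth function `f` on `U` that is basic for
`G|_U` and nondegenerate along `O` in the sense of Bott, i.e. at each `y ∈ O` the kernel of the
Hessian of `f` is `T_y O` (the Hessian induces a nondegenerate form on `T_y M / T_y O`). -/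
def IsNondegenerateCriticalOrbit (𝒢 : LieGroupoid n d M G) (α : OneForm n M) (x : M) : Prop :=
  α x = 0 ∧
  ∃ U : Set M, IsOpen U ∧ 𝒢.orbit x ⊆ U ∧
  ∃ f : M → ℝ, ContMDiffOn (𝓡 n) 𝓘(ℝ, ℝ) ∞ f U ∧ 𝒢.IsBasicOn f U ∧
    (∀ y ∈ U, α y = mvfderiv (𝓡 n) f y) ∧
    ∀ y ∈ 𝒢.orbit x, ∀ v : TangentSpace (𝓡 n) y,
      (∀ w : TangentSpace (𝓡 n) y, hessianAt f y v w = 0) ↔ v ∈ 𝒢.orbitTangent y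

/-- `α` is a Morse closed basic 1-form on `G ⇉ M`: it is closed, basic, and all its critical orbits
are nondegenerate. -/
structure IsMorseClosedBasic (𝒢 : LieGroupoid n d M G) (α : OneForm n M) : Prop where
  closed : α.IsClosedForm
  basic : 𝒢.IsBasic α
  nondegenerate : ∀ x : M, α x = 0 → 𝒢.IsNondegenerateCriticalOrbit α x

end LieGroupoid

end

/-! A bibundle compares the two sides on `P`. If two smooth maps `f`, `g` into `P` have the same
left anchor, right principality gives a smooth map `δ(f, g)` into `G'` with target `right ∘ f` and
source `right ∘ g`; hence a basic form `α'` has the same pullback along `right ∘ f` and `right ∘ g`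
(`pullbackAt_right_eq`). So the pullback of `α'` along `right ∘ σ` does not depend on the local
section `σ` of `left`, and these pullbacks glue to a form `α` with `left^* α = right^* α'`
(`exists_related`). Being locally a pullback, `α` is smooth and closed; it is basic because `right`
is invariant under `G`; it is unique because `left` is a surjective submersion.

For the critical orbits, a local primitive `f'` of `α'` descends in the same way to `f` with `f ∘
left = f' ∘ right`. At a critical point the Hessian is natural, so the Hessians of `f` and `f'` have
the same pullback to `T_q P`. The tangent spaces of the two orbits also have the same preimage in
`T_q P` (`modelDeriv_mem_orbitTangent_iff`). As both anchors have surjective derivatives, the Bott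
condition passes from one side to the other (`Related.isNondegenerateCriticalOrbit`). The opposite
bibundle `symm` supplies every converse. -/

noncomputable section

open Filter Topology

/-! ### Local sections of submersions -/

/-- A submersion admits a smooth local section through every point of its domain. -/
theorem Manifold.IsSubmersion.exists_localSection {n k : ℕ} {M P : Type*}
    [TopologicalSpace M] [ChartedSpace (Eucl n) M] [IsManifold (𝓡 n) ∞ M]
    [TopologicalSpace P] [ChartedSpace (Eucl k) P] [IsManifold (𝓡 k) ∞ P]
    {f : P → M} (hf : Manifold.IsSubmersion (𝓡 k) (𝓡 n) ∞ f) (p : P) :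
    ∃ σ : M → P, σ (f p) = p ∧ (∀ᶠ y in 𝓝 (f p), ContMDiffAt (𝓡 n) (𝓡 k) ∞ σ y) ∧
      ∀ᶠ y in 𝓝 (f p), f (σ y) = y := by
  have h := hf.isSubmersionAt p
  set φ := h.domChart with hφ
  set ψ := h.codChart with hψ
  have hpφ : p ∈ φ.source := h.mem_domChart_source
  have hpψ : f p ∈ ψ.source := h.mem_codChart_source
  have hloc : ∀ z ∈ (φ.extend (𝓡 k)).target,
      ψ.extend (𝓡 n) (f ((φ.extend (𝓡 k)).symm z)) = (h.equiv z).1 :=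
    fun z hz => h.writtenInCharts hz
  -- In the charts of the normal form `f` is the projection to the first factor; the section freezes
  -- the fibre coordinate at its value `c` at `p`.
  let c := (h.equiv (φ.extend (𝓡 k) p)).2
  let A : M → Eucl k := fun y => h.equiv.symm (ψ.extend (𝓡 n) y, c)
  have hpt : φ.extend (𝓡 k) p ∈ (φ.extend (𝓡 k)).target :=
    (φ.extend (𝓡 k)).map_source (by simpa using hpφ)
  have hAp : A (f p) = φ.extend (𝓡 k) p := by
    have h1 := hloc _ hpt
    rw [(φ.extend (𝓡 k)).left_inv (by simpa using hpφ)] at h1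
    simp only [A, c, h1]
    simp
  have hlin : ContMDiff 𝓘(ℝ, Eucl n) 𝓘(ℝ, Eucl k) ∞ (fun v : Eucl n => h.equiv.symm (v, c)) := by
    rw [contMDiff_iff_contDiff]
    exact h.equiv.symm.contDiff.comp (contDiff_id.prodMk contDiff_const)
  have hA : ∀ y ∈ ψ.source, ContMDiffAt (𝓡 n) 𝓘(ℝ, Eucl k) ∞ A y := fun y hy =>
    ContMDiffAt.comp y (g := fun v : Eucl n => h.equiv.symm (v, c)) hlin.contMDiffAt
      (ψ.contMDiffAt_extend h.codChart_mem_maximalAtlas hy)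
  have hopen : IsOpen (φ.extend (𝓡 k)).target := φ.isOpen_extend_target
  have hev : ∀ᶠ y in 𝓝 (f p), y ∈ ψ.source ∧ A y ∈ (φ.extend (𝓡 k)).target :=
    (Filter.eventually_mem_set.2 (ψ.open_source.mem_nhds hpψ)).and
      ((hA _ hpψ).continuousAt.preimage_mem_nhds (hopen.mem_nhds (hAp ▸ hpt)))
  refine ⟨fun y => (φ.extend (𝓡 k)).symm (A y), ?_, ?_, ?_⟩
  · simp only [hAp]
    exact (φ.extend (𝓡 k)).left_inv (by simpa using hpφ)
  · filter_upwards [hev] with y hy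
    have h2 : ContMDiffAt 𝓘(ℝ, Eucl k) (𝓡 k) ∞ (φ.extend (𝓡 k)).symm (A y) := by
      have h3 := contMDiffOn_extend_symm (I := 𝓡 k) h.domChart_mem_maximalAtlas
      refine h3.contMDiffAt (Filter.mem_of_superset (hopen.mem_nhds hy.2) fun z hz => ?_)
      exact ⟨z, by simpa using hz, rfl⟩
    exact ContMDiffAt.comp y h2 (hA y hy.1)
  · filter_upwards [hev] with y hy
    have h1 := hloc _ hy.2
    have hs : (φ.extend (𝓡 k)).symm (A y) ∈ φ.source := by
      simpa using (φ.extend (𝓡 k)).map_target hy.2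
    have h2 := h.source_subset_preimage_source hs
    have h3 : (h.equiv (A y)).1 = ψ.extend (𝓡 n) y := by simp [A]
    rw [h3] at h1
    exact (ψ.extend (𝓡 n)).injOn (by simpa using h2) (by simpa using hy.1) h1

/-- The composition of a map that is smooth on a set with a smooth map into that set. -/
theorem ContMDiffOn.comp_contMDiffAt_of_eventually_mem {a c : ℕ} {X Y Z : Type*}
    [TopologicalSpace X] [ChartedSpace (Eucl a) X]
    {HY EY : Type*} [TopologicalSpace HY] [NormedAddCommGroup EY] [NormedSpace ℝ EY]
    {J : ModelWithCorners ℝ EY HY} [TopologicalSpace Y] [ChartedSpace HY Y]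
    [TopologicalSpace Z] [ChartedSpace (Eucl c) Z]
    {F : Y → Z} {S : Set Y} (hF : ContMDiffOn J (𝓡 c) ∞ F S) {φ : X → Y} {x : X}
    (hφ : ContMDiffAt (𝓡 a) J ∞ φ x) (hS : ∀ᶠ x' in 𝓝 x, φ x' ∈ S) :
    ContMDiffAt (𝓡 a) (𝓡 c) ∞ (fun x' => F (φ x')) x := by
  have h1 : ContMDiffWithinAt (𝓡 a) (𝓡 c) ∞ (F ∘ φ) (φ ⁻¹' S) x :=
    (hF (φ x) hS.self_of_nhds).comp x hφ.contMDiffWithinAt (Set.mapsTo_preimage _ _)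
  exact h1.contMDiffAt hS

/-! ### Pullbacks of 1-forms and smoothness in charts -/

namespace OneForm

variable {n : ℕ} {M : Type*}
    [TopologicalSpace M] [ChartedSpace (Eucl n) M] [IsManifold (𝓡 n) ∞ M]

theorem pullbackAt_congr {k : ℕ} {N : Type*} [TopologicalSpace N] [ChartedSpace (Eucl k) N]
    (α : OneForm n M) {a b : N → M} {x : N} (h : a =ᶠ[𝓝 x] b) :
    α.pullbackAt k a x = α.pullbackAt k b x := by
  have h0 : a x = b x := h.self_of_nhds
  -- The derivatives end in tangent spaces over `a x` and `b x`. Both are the model space by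
  -- definition, so the types match; generalizing the derivatives then lets the base point be
  -- rewritten.
  have h1 : HEq (mfderiv (𝓡 k) (𝓡 n) a x) (mfderiv (𝓡 k) (𝓡 n) b x) := by
    exact heq_of_eq (Filter.EventuallyEq.mfderiv_eq h)
  unfold pullbackAt
  generalize mfderiv (𝓡 k) (𝓡 n) a x = A at h1
  generalize mfderiv (𝓡 k) (𝓡 n) b x = B at h1
  revert A B
  rw [h0]
  intro A B h1
  rw [eq_of_heq h1]

theorem pullbackAt_comp {k m : ℕ} {N L : Type*} [TopologicalSpace N] [ChartedSpace (Eucl k) N]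
    [TopologicalSpace L] [ChartedSpace (Eucl m) L]
    (α : OneForm n M) {a : N → M} {f : L → N} {x : L}
    (ha : MDifferentiableAt (𝓡 k) (𝓡 n) a (f x)) (hf : MDifferentiableAt (𝓡 m) (𝓡 k) f x) :
    α.pullbackAt m (fun y => a (f y)) x =
      (α.pullbackAt k a (f x)).comp (mfderiv (𝓡 m) (𝓡 k) f x) := by
  have := mfderiv_comp x ha hf
  unfold pullbackAt
  change (α (a (f x))).comp (mfderiv (𝓡 m) (𝓡 n) (a ∘ f) x) = _
  rw [this]
  rfl

/-- The expression in the chart around `x₀` of a field of covectors. -/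
def covectorInChart (β : ∀ x : M, TangentSpace (𝓡 n) x →L[ℝ] ℝ) (x₀ : M) (z : Eucl n) :
    Eucl n →L[ℝ] ℝ :=
  (β ((extChartAt (𝓡 n) x₀).symm z)).comp
    (mfderiv 𝓘(ℝ, Eucl n) (𝓡 n) (extChartAt (𝓡 n) x₀).symm z)

/-- A field of covectors is smooth at `x` if and only if its expression in the chart around `x`
is. -/
theorem contMDiffAt_covector_iff (β : ∀ x : M, TangentSpace (𝓡 n) x →L[ℝ] ℝ) (x : M) :
    ContMDiffAt (𝓡 n) ((𝓡 n).prod 𝓘(ℝ, Eucl n →L[ℝ] ℝ)) ∞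
        (fun y => Bundle.TotalSpace.mk' (Eucl n →L[ℝ] ℝ)
          (E := fun x : M => TangentSpace (𝓡 n) x →L[ℝ] ℝ) y (β y)) x ↔
      ContDiffAt ℝ ∞ (covectorInChart β x) (extChartAt (𝓡 n) x x) := by
  have hx : x ∈ (chartAt (Eucl n) x).source := mem_chart_source _ x
  -- The inverse of the tangent bundle trivialization at `x` is the derivative of the inverse chart,
  -- so bundle coordinates of `β` agree with its chart expression.
  have key : (fun y => ContinuousLinearMap.inCoordinates (Eucl n)
        (fun x : M => TangentSpace (𝓡 n) x) ℝ (fun _ : M => ℝ) x y x y (β y)) =ᶠ[𝓝 x]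
      fun y => covectorInChart β x (extChartAt (𝓡 n) x y) := by
    filter_upwards [(chartAt (Eucl n) x).open_source.mem_nhds hx] with y hy
    have hy' : (extChartAt (𝓡 n) x).symm (extChartAt (𝓡 n) x y) = y :=
      (extChartAt (𝓡 n) x).left_inv (by simpa using hy)
    have h1 := TangentBundle.symmL_trivializationAt (I := 𝓡 n) hy
    rw [ModelWithCorners.range_eq_univ, mfderivWithin_univ] at h1
    have h2 := congrArg (fun q : M => (show Eucl n →L[ℝ] ℝ from β q)) hy'
    simp only at h2
    ext v
    have h3 := congrArg (fun A : Eucl n →L[ℝ] Eucl n => (show Eucl n →L[ℝ] ℝ from β y) (A v)) h1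
    have h4 : (ContinuousLinearMap.inCoordinates (Eucl n)
        (fun x : M => TangentSpace (𝓡 n) x) ℝ (fun _ : M => ℝ) x y x y (β y)) v =
        β y ((trivializationAt (Eucl n) (fun x : M => TangentSpace (𝓡 n) x) x).symmL ℝ y v) := by
      simp [ContinuousLinearMap.inCoordinates]
    rw [h4]
    refine h3.trans ?_
    simp only [← h2]
    rfl
  have hsm : ContMDiffAt (𝓡 n) 𝓘(ℝ, Eucl n) ∞ (extChartAt (𝓡 n) x) x := contMDiffAt_extChartAt
  have hsm' : ContMDiffAt 𝓘(ℝ, Eucl n) (𝓡 n) ∞ (extChartAt (𝓡 n) x).symm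
      (extChartAt (𝓡 n) x x) :=
    (contMDiffOn_extChartAt_symm x).contMDiffAt (extChartAt_target_mem_nhds x)
  have h := contMDiffAt_hom_bundle (IB := 𝓡 n) (IM := 𝓡 n) (n := ∞) (x₀ := x)
    (fun y => Bundle.TotalSpace.mk' (Eucl n →L[ℝ] ℝ)
          (E := fun x : M => TangentSpace (𝓡 n) x →L[ℝ] ℝ) y (β y))
  refine h.trans ?_
  constructor
  · rintro ⟨-, h2⟩
    have h3 := h2.congr_of_eventuallyEq key.symm
    rw [← contMDiffAt_iff_contDiffAt]
    have h4 := ContMDiffAt.comp_of_eq (x := extChartAt (𝓡 n) x x) h3 hsm' (by simp)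
    refine h4.congr_of_eventuallyEq ?_
    filter_upwards [extChartAt_target_mem_nhds x] with z hz
    exact congrArg _ ((extChartAt (𝓡 n) x).right_inv hz).symm
  · intro h2
    refine ⟨contMDiffAt_id, ?_⟩
    refine ContMDiffAt.congr_of_eventuallyEq ?_ key
    exact ContMDiffAt.comp x h2.contMDiffAt hsm

end OneForm

/-! ### Forms that are locally pullbacks: smoothness and closedness -/

namespace OneForm

variable {n n' : ℕ} {M M' : Type*}
    [TopologicalSpace M] [ChartedSpace (Eucl n) M] [IsManifold (𝓡 n) ∞ M]
    [TopologicalSpace M'] [ChartedSpace (Eucl n') M'] [IsManifold (𝓡 n') ∞ M']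

/-- A field of covectors is locally the pullback of `α` at `y`. -/
def IsLocalPullbackAt (β : ∀ x : M, TangentSpace (𝓡 n) x →L[ℝ] ℝ) (α : OneForm n' M')
    (b : M → M') (y : M) : Prop :=
  (∀ᶠ x in 𝓝 y, ContMDiffAt (𝓡 n) (𝓡 n') ∞ b x) ∧ ∀ᶠ x in 𝓝 y, β x = α.pullbackAt n b x

/-- The expression of `b : M → M'` in the chart around `x₀` and the preferred chart at the image of
the point with coordinates `z₀`. -/
def mapInChart (n n' : ℕ) {M M' : Type*} [TopologicalSpace M] [ChartedSpace (Eucl n) M]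
    [TopologicalSpace M'] [ChartedSpace (Eucl n') M'] (b : M → M') (x₀ : M) (z₀ z : Eucl n) :
    Eucl n' :=
  extChartAt (𝓡 n') (b ((extChartAt (𝓡 n) x₀).symm z₀)) (b ((extChartAt (𝓡 n) x₀).symm z))

theorem contMDiffAt_extChartAt_symm {x₀ : M} {z : Eucl n}
    (hz : z ∈ (extChartAt (𝓡 n) x₀).target) :
    ContMDiffAt 𝓘(ℝ, Eucl n) (𝓡 n) ∞ (extChartAt (𝓡 n) x₀).symm z :=
  (contMDiffOn_extChartAt_symm x₀).contMDiffAt ((isOpen_extChartAt_target x₀).mem_nhds hz)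

theorem contDiffAt_mapInChart {b : M → M'} {x₀ : M} {z₀ z : Eucl n}
    (hz : z ∈ (extChartAt (𝓡 n) x₀).target)
    (hb : ContMDiffAt (𝓡 n) (𝓡 n') ∞ b ((extChartAt (𝓡 n) x₀).symm z))
    (hbz : b ((extChartAt (𝓡 n) x₀).symm z) ∈
      (chartAt (Eucl n') (b ((extChartAt (𝓡 n) x₀).symm z₀))).source) :
    ContDiffAt ℝ ∞ (mapInChart n n' b x₀ z₀) z := by
  rw [← contMDiffAt_iff_contDiffAt]
  exact ContMDiffAt.comp z (contMDiffAt_extChartAt' hbz)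
    (ContMDiffAt.comp z hb (contMDiffAt_extChartAt_symm hz))

/-- With `F` the coordinate expression of `b`, one has `b ∘ φ⁻¹ = ψ⁻¹ ∘ F` near `z₀`; the chain rule
applied to both sides gives the formula. It reduces smoothness and closedness to pullbacks between
Euclidean spaces. -/
theorem IsLocalPullbackAt.covectorInChart_eventuallyEq
    {β : ∀ x : M, TangentSpace (𝓡 n) x →L[ℝ] ℝ} {α : OneForm n' M'} {b : M → M'}
    {x₀ : M} {z₀ : Eucl n} (hz₀ : z₀ ∈ (extChartAt (𝓡 n) x₀).target)
    (h : IsLocalPullbackAt β α b ((extChartAt (𝓡 n) x₀).symm z₀)) :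
    covectorInChart β x₀ =ᶠ[𝓝 z₀] fun z =>
      (α.inChart (b ((extChartAt (𝓡 n) x₀).symm z₀)) (mapInChart n n' b x₀ z₀ z)).comp
        (fderiv ℝ (mapInChart n n' b x₀ z₀) z) := by
  set φ := extChartAt (𝓡 n) x₀
  set w₀ := b (φ.symm z₀) with hw₀
  have hφ : ContinuousAt φ.symm z₀ := (contMDiffAt_extChartAt_symm hz₀).continuousAt
  have hb : ContinuousAt (fun z => b (φ.symm z)) z₀ :=
    ContinuousAt.comp (f := φ.symm) (x := z₀) h.1.self_of_nhds.continuousAt hφ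
  have hsrc : ∀ᶠ z in 𝓝 z₀, b (φ.symm z) ∈ (chartAt (Eucl n') w₀).source :=
    hb.preimage_mem_nhds ((chartAt (Eucl n') w₀).open_source.mem_nhds (mem_chart_source _ w₀))
  have htgt : ∀ᶠ z in 𝓝 z₀, z ∈ φ.target := (isOpen_extChartAt_target x₀).mem_nhds hz₀
  filter_upwards [hsrc.eventually_nhds, htgt, hφ.eventually h.1, hφ.eventually h.2]
    with z hz hzt hz1 hz2
  have hF : ContDiffAt ℝ ∞ (mapInChart n n' b x₀ z₀) z :=
    contDiffAt_mapInChart hzt hz1 hz.self_of_nhds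
  have hψ : ContMDiffAt 𝓘(ℝ, Eucl n') (𝓡 n') ∞ (extChartAt (𝓡 n') w₀).symm
      (mapInChart n n' b x₀ z₀ z) :=
    contMDiffAt_extChartAt_symm ((extChartAt (𝓡 n') w₀).map_source
      (by rw [extChartAt_source]; exact hz.self_of_nhds))
  have e1 : covectorInChart β x₀ z = α.pullbackAt n (fun z => b (φ.symm z)) z := by
    rw [pullbackAt_comp α (hz1.mdifferentiableAt (by simp))
      ((contMDiffAt_extChartAt_symm hzt).mdifferentiableAt (by simp)), ← hz2]
    rfl
  have e2 : (fun z => b (φ.symm z)) =ᶠ[𝓝 z]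
      fun z => (extChartAt (𝓡 n') w₀).symm (mapInChart n n' b x₀ z₀ z) := by
    filter_upwards [hz] with z' hz'
    exact ((extChartAt (𝓡 n') w₀).left_inv (by rwa [extChartAt_source])).symm
  rw [e1, pullbackAt_congr α e2, pullbackAt_comp α (hψ.mdifferentiableAt (by simp))
    (hF.contMDiffAt.mdifferentiableAt (by simp)), mfderiv_eq_fderiv]
  rfl

theorem contDiffAt_inChart (α : OneForm n M) (x : M) :
    ContDiffAt ℝ ∞ (α.inChart x) (extChartAt (𝓡 n) x x) :=
  (contMDiffAt_covector_iff (fun y => α y) x).1 (α.contMDiff_toFun x)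

theorem IsLocalPullbackAt.contMDiffAt {β : ∀ x : M, TangentSpace (𝓡 n) x →L[ℝ] ℝ}
    {α : OneForm n' M'} {b : M → M'} {x : M} (h : IsLocalPullbackAt β α b x) :
    ContMDiffAt (𝓡 n) ((𝓡 n).prod 𝓘(ℝ, Eucl n →L[ℝ] ℝ)) ∞
        (fun y => Bundle.TotalSpace.mk' (Eucl n →L[ℝ] ℝ)
          (E := fun x : M => TangentSpace (𝓡 n) x →L[ℝ] ℝ) y (β y)) x := by
  rw [contMDiffAt_covector_iff]
  have hx : (extChartAt (𝓡 n) x).symm (extChartAt (𝓡 n) x x) = x := by simp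
  rw [← hx] at h
  have ht := mem_extChartAt_target (I := 𝓡 n) x
  refine ContDiffAt.congr_of_eventuallyEq ?_ (h.covectorInChart_eventuallyEq ht)
  have hF : ContDiffAt ℝ ∞ (mapInChart n n' b x (extChartAt (𝓡 n) x x)) (extChartAt (𝓡 n) x x) :=
    contDiffAt_mapInChart ht h.1.self_of_nhds (mem_chart_source _ _)
  refine ContDiffAt.clm_comp ?_ (hF.fderiv_right (by simp))
  exact ContDiffAt.comp (extChartAt (𝓡 n) x x)
    (f := mapInChart n n' b x (extChartAt (𝓡 n) x x)) (contDiffAt_inChart α _) hF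

/-- The exterior derivative commutes with pullback, so in coordinates `dα = F^* dα' = 0`. -/
theorem IsClosedForm.of_isLocalPullbackAt {α : OneForm n M} {α' : OneForm n' M'}
    (hα' : α'.IsClosedForm)
    (h : ∀ x, ∃ b : M → M', IsLocalPullbackAt (fun y => α y) α' b x) : α.IsClosedForm := by
  intro x₀ z₀ hz₀
  obtain ⟨b, hb⟩ := h ((extChartAt (𝓡 n) x₀).symm z₀)
  have e := hb.covectorInChart_eventuallyEq hz₀
  set w₀ := b ((extChartAt (𝓡 n) x₀).symm z₀)
  set F := mapInChart n n' b x₀ z₀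
  have hF : ContDiffAt ℝ ∞ F z₀ :=
    contDiffAt_mapInChart hz₀ hb.1.self_of_nhds (mem_chart_source _ _)
  let ω' : Eucl n' → (Eucl n') [⋀^Fin 1]→L[ℝ] ℝ := fun y =>
    ContinuousAlternatingMap.ofSubsingleton ℝ (Eucl n') ℝ (0 : Fin 1) (α'.inChart w₀ y)
  have hω' : DifferentiableAt ℝ ω' (F z₀) := by
    have h1 := (contDiffAt_inChart α' w₀).differentiableAt (by simp)
    exact ((ContinuousAlternatingMap.ofSubsingletonLIE (𝕜 := ℝ) (E := Eucl n') (F := ℝ)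
      (0 : Fin 1)).toContinuousLinearEquiv.differentiableAt).comp _ h1
  have e' : (fun y => ContinuousAlternatingMap.ofSubsingleton ℝ (Eucl n) ℝ (0 : Fin 1)
      (α.inChart x₀ y)) =ᶠ[𝓝 z₀]
      fun z => (ω' (F z)).compContinuousLinearMap (fderiv ℝ F z) := by
    filter_upwards [e] with z hz
    have hz' : α.inChart x₀ z = (α'.inChart w₀ (F z)).comp (fderiv ℝ F z) := hz
    rw [hz']
    ext v
    simp [ω']
  rw [e'.extDeriv_eq, extDeriv_pullback hω' hF (by
    simp only [minSmoothness_of_isRCLikeNormedField]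
    exact WithTop.coe_le_coe.2 (le_top : (2 : ℕ∞) ≤ ⊤))]
  rw [hα' w₀ (F z₀) (mem_extChartAt_target w₀)]
  ext v
  simp

end OneForm

/-! ### The opposite bibundle -/

namespace LieGroupoid

variable {n d : ℕ} {M G : Type*}
    [TopologicalSpace M] [ChartedSpace (Eucl n) M] [IsManifold (𝓡 n) ∞ M]
    [TopologicalSpace G] [ChartedSpace (Eucl d) G] [IsManifold (𝓡 d) ∞ G]
    (𝒢 : LieGroupoid n d M G)

theorem eq_inv_of_mul_eq_unit {g h : G} (hgh : 𝒢.src g = 𝒢.tgt h)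
    (H : 𝒢.mul g h = 𝒢.unit (𝒢.src h)) : g = 𝒢.inv h := by
  have h1 := 𝒢.mul_assoc g h (𝒢.inv h) hgh (𝒢.tgt_inv h).symm
  rw [H, 𝒢.mul_inv, ← hgh, 𝒢.mul_unit, ← 𝒢.tgt_inv h, 𝒢.unit_mul] at h1
  exact h1.symm

theorem inv_unit (x : M) : 𝒢.inv (𝒢.unit x) = 𝒢.unit x := by
  refine (𝒢.eq_inv_of_mul_eq_unit ((𝒢.src_unit x).trans (𝒢.tgt_unit x).symm) ?_).symm
  have := 𝒢.mul_unit (𝒢.unit x)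
  rw [𝒢.src_unit] at this ⊢
  exact this

theorem inv_mul_rev {g h : G} (hgh : 𝒢.src g = 𝒢.tgt h) :
    𝒢.inv (𝒢.mul g h) = 𝒢.mul (𝒢.inv h) (𝒢.inv g) := by
  have hc : 𝒢.src (𝒢.inv h) = 𝒢.tgt (𝒢.inv g) := by rw [𝒢.src_inv, 𝒢.tgt_inv, hgh]
  refine (𝒢.eq_inv_of_mul_eq_unit ?_ ?_).symm
  · rw [𝒢.src_mul _ _ hc, 𝒢.src_inv, 𝒢.tgt_mul _ _ hgh]
  · rw [𝒢.mul_assoc _ _ _ hc (by rw [𝒢.src_inv, 𝒢.tgt_mul _ _ hgh]),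
      ← 𝒢.mul_assoc _ _ _ (𝒢.src_inv g) hgh, 𝒢.inv_mul, hgh, 𝒢.unit_mul, 𝒢.inv_mul,
      𝒢.src_mul _ _ hgh]

theorem src_smooth : ContMDiff (𝓡 d) (𝓡 n) ∞ 𝒢.src := 𝒢.src_submersion.contMDiff

theorem tgt_smooth : ContMDiff (𝓡 d) (𝓡 n) ∞ 𝒢.tgt := 𝒢.tgt_submersion.contMDiff

end LieGroupoid

namespace PrincipalBibundle

variable {n d n' d' : ℕ} {M G M' G' : Type*}
    [TopologicalSpace M] [ChartedSpace (Eucl n) M] [IsManifold (𝓡 n) ∞ M]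
    [TopologicalSpace G] [ChartedSpace (Eucl d) G] [IsManifold (𝓡 d) ∞ G]
    [TopologicalSpace M'] [ChartedSpace (Eucl n') M'] [IsManifold (𝓡 n') ∞ M']
    [TopologicalSpace G'] [ChartedSpace (Eucl d') G'] [IsManifold (𝓡 d') ∞ G']
    {𝒢 : LieGroupoid n d M G} {𝒢' : LieGroupoid n' d' M' G'}
    {k : ℕ} {P : Type*}
    [TopologicalSpace P] [ChartedSpace (Eucl k) P] [IsManifold (𝓡 k) ∞ P]
    (B : PrincipalBibundle 𝒢 𝒢' k P)

theorem inv_lact_lact {g : G} {p : P} (h : 𝒢.src g = B.left p) :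
    B.lact (𝒢.inv g) (B.lact g p) = p := by
  rw [← B.mul_lact _ _ _ (𝒢.src_inv g) h, 𝒢.inv_mul, h, B.unit_lact]

theorem lact_lact_inv {g : G} {p : P} (h : 𝒢.tgt g = B.left p) :
    B.lact g (B.lact (𝒢.inv g) p) = p := by
  rw [← B.mul_lact _ _ _ (𝒢.tgt_inv g).symm (by rw [𝒢.src_inv, h]), 𝒢.mul_inv, h, B.unit_lact]

theorem ract_ract_inv {h : G'} {p : P} (hp : B.right p = 𝒢'.tgt h) :
    B.ract (B.ract p h) (𝒢'.inv h) = p := by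
  rw [← B.ract_mul _ _ _ hp (𝒢'.tgt_inv h).symm, 𝒢'.mul_inv, ← hp, B.ract_unit]

theorem ract_inv_ract {h : G'} {p : P} (hp : B.right p = 𝒢'.src h) :
    B.ract (B.ract p (𝒢'.inv h)) h = p := by
  rw [← B.ract_mul _ _ _ (by rw [𝒢'.tgt_inv, hp]) (𝒢'.src_inv h), 𝒢'.inv_mul, ← hp, B.ract_unit]

/-- The opposite bibundle, obtained by exchanging the anchors and inverting the actions. -/
def symm : PrincipalBibundle 𝒢' 𝒢 k P where
  left := B.right
  right := B.left
  left_submersion := B.right_submersion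
  left_surjective := B.right_surjective
  right_submersion := B.left_submersion
  right_surjective := B.left_surjective
  lact h p := B.ract p (𝒢'.inv h)
  ract p g := B.lact (𝒢.inv g) p
  lact_smooth := by
    refine B.ract_smooth.comp (f := fun q : G' × P => (q.2, 𝒢'.inv q.1)) ?_ ?_
    · exact (contMDiff_snd.prodMk (𝒢'.inv_smooth.comp contMDiff_fst)).contMDiffOn
    · intro q hq
      simpa [𝒢'.tgt_inv] using Eq.symm hq
  ract_smooth := by
    refine B.lact_smooth.comp (f := fun q : P × G => (𝒢.inv q.2, q.1)) ?_ ?_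
    · exact ((𝒢.inv_smooth.comp contMDiff_snd).prodMk contMDiff_fst).contMDiffOn
    · intro q hq
      simpa [𝒢.src_inv] using Eq.symm hq
  left_lact h p hp := by
    rw [B.right_ract _ _ (by rw [𝒢'.tgt_inv, hp]), 𝒢'.src_inv]
  right_lact h p hp := B.left_ract _ _ (by rw [𝒢'.tgt_inv, hp])
  unit_lact p := by rw [𝒢'.inv_unit, B.ract_unit]
  mul_lact g h p hgh hp := by
    rw [𝒢'.inv_mul_rev hgh, B.ract_mul _ _ _ (by rw [𝒢'.tgt_inv, hp])
      (by rw [𝒢'.tgt_inv, 𝒢'.src_inv, hgh])]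
  right_ract p g hp := by
    rw [B.left_lact _ _ (by rw [𝒢.src_inv, hp]), 𝒢.tgt_inv]
  left_ract p g hp := B.right_lact _ _ (by rw [𝒢.src_inv, hp])
  ract_unit p := by rw [𝒢.inv_unit, B.unit_lact]
  ract_mul p g h hp hgh := by
    rw [𝒢.inv_mul_rev hgh, B.mul_lact _ _ _ (by rw [𝒢.tgt_inv, 𝒢.src_inv, hgh])
      (by rw [𝒢.src_inv, hp])]
  lact_ract h p g hp hg :=
    (B.lact_ract _ _ _ (by rw [𝒢.src_inv, hg]) (by rw [𝒢'.tgt_inv, hp])).symm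
  left_principal := by
    obtain ⟨δ, hδ, h1, h2⟩ := B.right_principal
    -- The same division map serves, since `p h = q` exactly when `p = q h⁻¹`.
    refine ⟨δ, hδ, fun p q hpq => ?_, fun h q hq => ?_⟩
    · obtain ⟨h3, h4⟩ := h1 p q hpq
      constructor
      · rw [← B.right_ract _ _ h3, h4]
      · have := B.ract_ract_inv h3
        rwa [h4] at this
    · have := h2 (B.ract q (𝒢'.inv h)) h
        (by rw [B.right_ract _ _ (by rw [𝒢'.tgt_inv, hq]), 𝒢'.src_inv])
      rwa [B.ract_inv_ract hq.symm] at this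
  right_principal := by
    obtain ⟨δ, hδ, h1, h2⟩ := B.left_principal
    refine ⟨δ, hδ, fun p q hpq => ?_, fun p g hg => ?_⟩
    · obtain ⟨h3, h4⟩ := h1 p q hpq
      constructor
      · rw [← B.left_lact _ _ h3, h4]
      · have := B.inv_lact_lact h3
        rwa [h4] at this
    · have := h2 g (B.lact (𝒢.inv g) p)
        (by rw [B.left_lact _ _ (by rw [𝒢.src_inv, hg]), 𝒢.tgt_inv])
      rwa [B.lact_lact_inv hg.symm] at this

theorem left_smooth : ContMDiff (𝓡 k) (𝓡 n) ∞ B.left := B.left_submersion.contMDiff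

theorem right_smooth : ContMDiff (𝓡 k) (𝓡 n') ∞ B.right := B.right_submersion.contMDiff

/-- If `g` joins `left p` to `left q`, then `g p` and `q` share their left anchor, so `q = (g p) h`
with `h` in `G'`. As `right (g p) = right p`, the arrow `h⁻¹` joins `right p` to `right q`. -/
theorem right_mem_orbit_of_left_mem_orbit {p q : P} (h : B.left q ∈ 𝒢.orbit (B.left p)) :
    B.right q ∈ 𝒢'.orbit (B.right p) := by
  obtain ⟨g, hs, ht⟩ := h
  obtain ⟨δ, -, h1, -⟩ := B.right_principal
  obtain ⟨h2, h3⟩ := h1 (B.lact g p) q (by rw [B.left_lact _ _ hs, ht])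
  refine ⟨𝒢'.inv (δ (B.lact g p) q), ?_, ?_⟩
  · rw [𝒢'.src_inv, ← h2, B.right_lact _ _ hs]
  · rw [𝒢'.tgt_inv, ← B.right_ract _ _ h2, h3]

theorem preimage_orbit_eq (p : P) :
    B.left ⁻¹' 𝒢.orbit (B.left p) = B.right ⁻¹' 𝒢'.orbit (B.right p) :=
  Set.ext fun _ => ⟨B.right_mem_orbit_of_left_mem_orbit, B.symm.right_mem_orbit_of_left_mem_orbit⟩

/-! ### Transport of basic forms -/

/-- The pullback of a basic form along the right anchor depends only on the left anchor. -/
theorem pullbackAt_right_eq {α' : OneForm n' M'} (hα' : 𝒢'.IsBasic α')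
    {m : ℕ} {N : Type*} [TopologicalSpace N] [ChartedSpace (Eucl m) N]
    {f g : N → P} {x : N} (hf : ContMDiffAt (𝓡 m) (𝓡 k) ∞ f x)
    (hg : ContMDiffAt (𝓡 m) (𝓡 k) ∞ g x) (hfg : ∀ᶠ y in 𝓝 x, B.left (f y) = B.left (g y)) :
    α'.pullbackAt m (fun y => B.right (f y)) x = α'.pullbackAt m (fun y => B.right (g y)) x := by
  obtain ⟨δ, hδ, h1, -⟩ := B.right_principal
  have hh : ContMDiffAt (𝓡 m) (𝓡 d') ∞ (fun y => δ (f y) (g y)) x :=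
    hδ.comp_contMDiffAt_of_eventually_mem (φ := fun y => (f y, g y)) (hf.prodMk hg) hfg
  have ht : (fun y => B.right (f y)) =ᶠ[𝓝 x] fun y => 𝒢'.tgt (δ (f y) (g y)) := by
    filter_upwards [hfg] with y hy using (h1 _ _ hy).1
  have hs : (fun y => B.right (g y)) =ᶠ[𝓝 x] fun y => 𝒢'.src (δ (f y) (g y)) := by
    filter_upwards [hfg] with y hy
    rw [← B.right_ract _ _ (h1 _ _ hy).1, (h1 _ _ hy).2]
  have hd := hh.mdifferentiableAt (by simp)
  rw [α'.pullbackAt_congr ht, α'.pullbackAt_congr hs,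
    α'.pullbackAt_comp (𝒢'.tgt_smooth.mdifferentiableAt (by simp)) hd,
    α'.pullbackAt_comp (𝒢'.src_smooth.mdifferentiableAt (by simp)) hd, hα']

/-- The forms `α` and `α'` have the same pullback to the bibundle. -/
def Related (α : OneForm n M) (α' : OneForm n' M') : Prop :=
  ∀ p : P, α.pullbackAt k B.left p = α'.pullbackAt k B.right p

variable {B} in
theorem Related.symm {α : OneForm n M} {α' : OneForm n' M'} (h : B.Related α α') :
    B.symm.Related α' α := fun p => (h p).symm

variable {B} in
theorem Related.pullbackAt_comp {α : OneForm n M} {α' : OneForm n' M'} (h : B.Related α α')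
    {m : ℕ} {N : Type*} [TopologicalSpace N] [ChartedSpace (Eucl m) N]
    {f : N → P} {x : N} (hf : ContMDiffAt (𝓡 m) (𝓡 k) ∞ f x) :
    α.pullbackAt m (fun y => B.left (f y)) x = α'.pullbackAt m (fun y => B.right (f y)) x := by
  have hd := hf.mdifferentiableAt (by simp)
  rw [α.pullbackAt_comp (B.left_smooth.mdifferentiableAt (by simp)) hd,
    α'.pullbackAt_comp (B.right_smooth.mdifferentiableAt (by simp)) hd, h]

/-- A basic form on `M'` is related to a form on `M`, which is locally the pullback of the given
form. -/
theorem exists_related {α' : OneForm n' M'} (hα' : 𝒢'.IsBasic α') :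
    ∃ α : OneForm n M, B.Related α α' ∧
      ∀ x, ∃ b : M → M', OneForm.IsLocalPullbackAt (fun y => α y) α' b x := by
  have hsec : ∀ x : M, ∃ σ : M → P, (∀ᶠ y in 𝓝 x, ContMDiffAt (𝓡 n) (𝓡 k) ∞ σ y) ∧
      ∀ᶠ y in 𝓝 x, B.left (σ y) = y := by
    intro x
    obtain ⟨p, rfl⟩ := B.left_surjective x
    obtain ⟨σ, -, h⟩ := B.left_submersion.exists_localSection p
    exact ⟨σ, h⟩
  choose σ hσ hσl using hsec
  let β : ∀ x : M, TangentSpace (𝓡 n) x →L[ℝ] ℝ := fun x =>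
    α'.pullbackAt n (fun y => B.right (σ x y)) x
  have hβ : ∀ x, OneForm.IsLocalPullbackAt β α' (fun y => B.right (σ x y)) x := by
    intro x
    refine ⟨?_, ?_⟩
    · filter_upwards [hσ x] with y hy using B.right_smooth.contMDiffAt.comp y hy
    · filter_upwards [hσ x, (hσl x).eventually_nhds] with y hy hy'
      -- The sections chosen at `x` and at `y` are both lifts of the identity near `y`.
      refine B.pullbackAt_right_eq hα' (hσ y).self_of_nhds hy ?_
      filter_upwards [hσl y, hy'] with z h1 h2
      rw [h1, h2]
  refine ⟨⟨β, fun x => (hβ x).contMDiffAt⟩, fun p => ?_, fun x => ⟨_, hβ x⟩⟩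
  have hl : ContMDiffAt (𝓡 k) (𝓡 n) ∞ B.left p := B.left_smooth.contMDiffAt
  have hs := (hσ (B.left p)).self_of_nhds
  -- The identity of `P` and `σ ∘ left` have the same left anchor near `p`, so `right^* α'` is the
  -- pullback along `right ∘ σ ∘ left`, that is, `left^* β`.
  have h1 := B.pullbackAt_right_eq hα' (f := fun q => q)
    (g := fun q => σ (B.left p) (B.left q)) contMDiffAt_id (ContMDiffAt.comp p hs hl) (by
      filter_upwards [hl.continuousAt.eventually (hσl (B.left p))] with q hq
      exact hq.symm)
  have hr : MDifferentiableAt (𝓡 n) (𝓡 n') (fun y => B.right (σ (B.left p) y)) (B.left p) :=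
    (B.right_smooth.contMDiffAt.comp (B.left p) hs).mdifferentiableAt (by simp)
  have h2 := α'.pullbackAt_comp hr (hl.mdifferentiableAt (by simp))
  exact (h1.trans h2).symm

-- Locally `src` and `tgt` lift through `left` to `g ↦ σ (src g)` and `g ↦ g · σ (src g)`. These
-- lifts have the same right anchor, so both pullbacks of `α` are the pullback of `α'` along one
-- map.
variable {B} in
theorem Related.isBasic {α : OneForm n M} {α' : OneForm n' M'} (h : B.Related α α') :
    𝒢.IsBasic α := by
  intro g
  obtain ⟨p, hp⟩ := B.left_surjective (𝒢.src g)
  obtain ⟨σ, -, hσ, hσl⟩ := B.left_submersion.exists_localSection p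
  rw [hp] at hσ hσl
  have hsg : ContMDiffAt (𝓡 d) (𝓡 n) ∞ 𝒢.src g := 𝒢.src_smooth.contMDiffAt
  have hev : ∀ᶠ g' in 𝓝 g, B.left (σ (𝒢.src g')) = 𝒢.src g' := hsg.continuousAt.eventually hσl
  have hf₁ : ContMDiffAt (𝓡 d) (𝓡 k) ∞ (fun g' => σ (𝒢.src g')) g :=
    ContMDiffAt.comp g hσ.self_of_nhds hsg
  have hf₂ : ContMDiffAt (𝓡 d) (𝓡 k) ∞ (fun g' => B.lact g' (σ (𝒢.src g'))) g :=
    B.lact_smooth.comp_contMDiffAt_of_eventually_mem (φ := fun g' => (g', σ (𝒢.src g')))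
      (contMDiffAt_id.prodMk hf₁) (by filter_upwards [hev] with g' hg' using hg'.symm)
  have e₁ : 𝒢.src =ᶠ[𝓝 g] fun g' => B.left (σ (𝒢.src g')) := by
    filter_upwards [hev] with g' hg' using hg'.symm
  have e₂ : 𝒢.tgt =ᶠ[𝓝 g] fun g' => B.left (B.lact g' (σ (𝒢.src g'))) := by
    filter_upwards [hev] with g' hg' using (B.left_lact _ _ hg'.symm).symm
  have e₃ : (fun g' => B.right (B.lact g' (σ (𝒢.src g')))) =ᶠ[𝓝 g]
      fun g' => B.right (σ (𝒢.src g')) := by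
    filter_upwards [hev] with g' hg' using B.right_lact _ _ hg'.symm
  rw [α.pullbackAt_congr e₁, α.pullbackAt_congr e₂, h.pullbackAt_comp hf₁, h.pullbackAt_comp hf₂,
    α'.pullbackAt_congr e₃]

end PrincipalBibundle

/-! ### Derivatives as maps between model spaces -/

/-- The derivative of `f : X → Y` at `x`, with the tangent spaces identified with the model
spaces. -/
def modelDeriv (a b : ℕ) {X Y : Type*} [TopologicalSpace X] [ChartedSpace (Eucl a) X]
    [TopologicalSpace Y] [ChartedSpace (Eucl b) Y] (f : X → Y) (x : X) : Eucl a →L[ℝ] Eucl b :=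
  mfderiv (𝓡 a) (𝓡 b) f x

section modelDeriv

variable {a b c : ℕ} {X Y Z : Type*} [TopologicalSpace X] [ChartedSpace (Eucl a) X]
    [TopologicalSpace Y] [ChartedSpace (Eucl b) Y] [TopologicalSpace Z] [ChartedSpace (Eucl c) Z]

theorem modelDeriv_comp {g : Y → Z} {f : X → Y} {x : X} {y : Y} (hxy : f x = y)
    (hg : ContMDiffAt (𝓡 b) (𝓡 c) ∞ g y) (hf : ContMDiffAt (𝓡 a) (𝓡 b) ∞ f x) :
    modelDeriv a c (fun x => g (f x)) x = (modelDeriv b c g y).comp (modelDeriv a b f x) := by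
  subst hxy
  exact mfderiv_comp x (hg.mdifferentiableAt (by simp)) (hf.mdifferentiableAt (by simp))

theorem modelDeriv_congr {f g : X → Y} {x : X} (h : f =ᶠ[𝓝 x] g) :
    modelDeriv a b f x = modelDeriv a b g x :=
  Filter.EventuallyEq.mfderiv_eq h

theorem modelDeriv_of_eventually_id {f : X → X} {x : X} (h : ∀ᶠ y in 𝓝 x, f y = y) :
    modelDeriv a a f x = ContinuousLinearMap.id ℝ (Eucl a) := by
  have h1 : f =ᶠ[𝓝 x] id := h
  rw [modelDeriv_congr h1]
  exact mfderiv_id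

end modelDeriv

theorem Manifold.IsSubmersion.modelDeriv_surjective {n k : ℕ} {M P : Type*}
    [TopologicalSpace M] [ChartedSpace (Eucl n) M] [IsManifold (𝓡 n) ∞ M]
    [TopologicalSpace P] [ChartedSpace (Eucl k) P] [IsManifold (𝓡 k) ∞ P]
    {f : P → M} (hf : Manifold.IsSubmersion (𝓡 k) (𝓡 n) ∞ f) (p : P) :
    Function.Surjective (modelDeriv k n f p) := by
  obtain ⟨σ, hσp, hσ, hσf⟩ := hf.exists_localSection p
  have h := modelDeriv_comp (g := f) hσp hf.contMDiff.contMDiffAt hσ.self_of_nhds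
  rw [modelDeriv_of_eventually_id hσf] at h
  exact fun v => ⟨modelDeriv n k σ (f p) v, (DFunLike.congr_fun h v).symm⟩

/-! ### The Hessian under composition -/

/-- The second derivative of a composition at a critical point of the outer function. -/
theorem fderiv_fderiv_comp_of_fderiv_eq_zero {E F : Type*} [NormedAddCommGroup E]
    [NormedSpace ℝ E] [NormedAddCommGroup F] [NormedSpace ℝ F] {g : F → ℝ} {A : E → F} {x : E}
    (hg : ContDiffAt ℝ 2 g (A x)) (hA : ContDiffAt ℝ 2 A x) (h0 : fderiv ℝ g (A x) = 0)
    (v w : E) :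
    fderiv ℝ (fderiv ℝ (g ∘ A)) x v w =
      fderiv ℝ (fderiv ℝ g) (A x) (fderiv ℝ A x v) (fderiv ℝ A x w) := by
  have e : fderiv ℝ (g ∘ A) =ᶠ[𝓝 x] fun z => (fderiv ℝ g (A z)).comp (fderiv ℝ A z) := by
    filter_upwards [hA.continuousAt.eventually (hg.eventually (by simp)),
      hA.eventually (by simp)] with z h1 h2
    exact fderiv_comp z (h1.differentiableAt (by simp)) (h2.differentiableAt (by simp))
  have h1 : HasFDerivAt (fderiv ℝ g) (fderiv ℝ (fderiv ℝ g) (A x)) (A x) :=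
    ((hg.fderiv_right (m := 1) (by norm_num)).differentiableAt (by simp)).hasFDerivAt
  have h2 : HasFDerivAt (fderiv ℝ A) (fderiv ℝ (fderiv ℝ A) x) x :=
    ((hA.fderiv_right (m := 1) (by norm_num)).differentiableAt (by simp)).hasFDerivAt
  have h3 := (h1.comp x (hA.differentiableAt (by simp)).hasFDerivAt).clm_comp h2
  -- The product rule adds a term in the second derivative of `A`, composed with `fderiv ℝ g (A x)`;
  -- it vanishes by `h0`.
  have h4 : fderiv ℝ (fun z => (fderiv ℝ g (A z)).comp (fderiv ℝ A z)) x = _ := h3.fderiv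
  rw [e.fderiv_eq, h4]
  simp [h0]

section hessian

variable {n k : ℕ} {M P : Type*} [TopologicalSpace M] [ChartedSpace (Eucl n) M]
    [TopologicalSpace P] [ChartedSpace (Eucl k) P] [IsManifold (𝓡 k) ∞ P]

theorem hessianAt_congr {f g : M → ℝ} {y : M} (h : f =ᶠ[𝓝 y] g) :
    hessianAt (n := n) f y = hessianAt g y := by
  have h1 : f ∘ (extChartAt (𝓡 n) y).symm =ᶠ[𝓝 (extChartAt (𝓡 n) y y)]
      g ∘ (extChartAt (𝓡 n) y).symm := by
    have h2 := continuousAt_extChartAt_symm (I := 𝓡 n) y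
    rw [ContinuousAt, extChartAt_to_inv] at h2
    exact h2.eventually h
  exact h1.fderiv.fderiv_eq

/-- The Hessian of `f` at `y`, as a bilinear form on the model space. -/
def modelHessian (f : M → ℝ) (y : M) (v w : Eucl n) : ℝ :=
  (hessianAt f y : Eucl n →L[ℝ] Eucl n →L[ℝ] ℝ) v w

theorem modelHessian_comp [IsManifold (𝓡 n) ∞ M] {a : P → M} {f : M → ℝ} {p : P} (ha : ContMDiff (𝓡 k) (𝓡 n) ∞ a)
    (hf : ContMDiffAt (𝓡 n) 𝓘(ℝ, ℝ) ∞ f (a p)) (h0 : mvfderiv (𝓡 n) f (a p) = 0)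
    (v w : Eucl k) :
    modelHessian (n := k) (fun q => f (a q)) p v w =
      modelHessian f (a p) (modelDeriv k n a p v) (modelDeriv k n a p w) := by
  set φ := extChartAt (𝓡 k) p
  set ψ := extChartAt (𝓡 n) (a p)
  have hφp : φ.symm (φ p) = p := extChartAt_to_inv p
  have hψp : ψ.symm (ψ (a p)) = a p := extChartAt_to_inv (a p)
  let A : Eucl k → Eucl n := fun z => ψ (a (φ.symm z))
  have hAp : A (φ p) = ψ (a p) := by simp only [A, hφp]
  have hφs : ContMDiffAt 𝓘(ℝ, Eucl k) (𝓡 k) ∞ φ.symm (φ p) :=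
    OneForm.contMDiffAt_extChartAt_symm (mem_extChartAt_target p)
  have hψs : ContMDiffAt 𝓘(ℝ, Eucl n) (𝓡 n) ∞ ψ.symm (ψ (a p)) :=
    OneForm.contMDiffAt_extChartAt_symm (mem_extChartAt_target (a p))
  have haφ : ContMDiffAt 𝓘(ℝ, Eucl k) (𝓡 n) ∞ (fun z => a (φ.symm z)) (φ p) :=
    ha.contMDiffAt.comp (φ p) hφs
  have hA : ContDiffAt ℝ ∞ A (φ p) := by
    rw [← contMDiffAt_iff_contDiffAt]
    exact ContMDiffAt.comp_of_eq contMDiffAt_extChartAt haφ (by rw [hφp])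
  have hfψ : ContDiffAt ℝ ∞ (f ∘ ψ.symm) (ψ (a p)) := by
    rw [← contMDiffAt_iff_contDiffAt]
    exact ContMDiffAt.comp_of_eq hf hψs hψp
  have h0' : fderiv ℝ (f ∘ ψ.symm) (ψ (a p)) = 0 := by
    have h1 := (hf.mdifferentiableAt (by simp)).mfderiv
    have h2 : mfderiv (𝓡 n) 𝓘(ℝ, ℝ) f (a p) = 0 := h0
    rw [h1, ModelWithCorners.range_eq_univ, fderivWithin_univ] at h2
    exact h2
  have hdA : fderiv ℝ A (φ p) = modelDeriv k n a p := by
    have h1 := (ha.mdifferentiable (by simp) p).mfderiv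
    rw [ModelWithCorners.range_eq_univ, fderivWithin_univ] at h1
    exact h1.symm
  have e : (fun q => f (a q)) ∘ φ.symm =ᶠ[𝓝 (φ p)] (f ∘ ψ.symm) ∘ A := by
    have hs : ∀ᶠ z in 𝓝 (φ p), a (φ.symm z) ∈ ψ.source :=
      haφ.continuousAt.preimage_mem_nhds (by
        rw [hφp]
        exact extChartAt_source_mem_nhds (a p))
    filter_upwards [hs] with z hz
    simp only [Function.comp_apply, A, ψ.left_inv hz]
  have h2 : (2 : ℕ∞ω) ≤ ∞ := WithTop.coe_le_coe.2 (le_top : (2 : ℕ∞) ≤ ⊤)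
  have h3 := fderiv_fderiv_comp_of_fderiv_eq_zero (g := f ∘ ψ.symm) (A := A) (x := φ p)
    (by rw [hAp]; exact hfψ.of_le h2) (hA.of_le h2) (by rw [hAp]; exact h0') v w
  rw [hdA, hAp] at h3
  change fderiv ℝ (fderiv ℝ ((fun q => f (a q)) ∘ φ.symm)) (φ p) v w = _
  rw [e.fderiv.fderiv_eq, h3]
  rfl

end hessian

/-! ### Transport of nondegenerate critical orbits -/

/-- Since `tgt (unit y) = y` is not definitional, `orbitTangent` compares vectors in the total space
of the tangent bundle. Over equal base points this is equality in the model space. -/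
theorem LieGroupoid.mem_orbitTangent_iff {n d : ℕ} {M G : Type*}
    [TopologicalSpace M] [ChartedSpace (Eucl n) M] [IsManifold (𝓡 n) ∞ M]
    [TopologicalSpace G] [ChartedSpace (Eucl d) G] [IsManifold (𝓡 d) ∞ G]
    (𝒢 : LieGroupoid n d M G) (y : M) (v : Eucl n) :
    (show TangentSpace (𝓡 n) y from v) ∈ 𝒢.orbitTangent y ↔
      ∃ w : Eucl d, modelDeriv d n 𝒢.src (𝒢.unit y) w = 0 ∧
        modelDeriv d n 𝒢.tgt (𝒢.unit y) w = v := by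
  have key : ∀ (x y : M) (u v : Eucl n), x = y →
      ((⟨x, u⟩ : TangentBundle (𝓡 n) M) = ⟨y, v⟩ ↔ u = v) := by
    rintro x _ u v rfl
    constructor
    · intro h
      exact eq_of_heq (Bundle.TotalSpace.mk.inj h).2
    · rintro rfl
      rfl
  refine exists_congr fun w => and_congr Iff.rfl ?_
  exact key _ _ _ _ (𝒢.tgt_unit y)

namespace PrincipalBibundle

variable {n d n' d' : ℕ} {M G M' G' : Type*}
    [TopologicalSpace M] [ChartedSpace (Eucl n) M] [IsManifold (𝓡 n) ∞ M]
    [TopologicalSpace G] [ChartedSpace (Eucl d) G] [IsManifold (𝓡 d) ∞ G]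
    [TopologicalSpace M'] [ChartedSpace (Eucl n') M'] [IsManifold (𝓡 n') ∞ M']
    [TopologicalSpace G'] [ChartedSpace (Eucl d') G'] [IsManifold (𝓡 d') ∞ G']
    {𝒢 : LieGroupoid n d M G} {𝒢' : LieGroupoid n' d' M' G'}
    {k : ℕ} {P : Type*}
    [TopologicalSpace P] [ChartedSpace (Eucl k) P] [IsManifold (𝓡 k) ∞ P]
    (B : PrincipalBibundle 𝒢 𝒢' k P)

/-- Vectors tangent to the fibres of the left anchor are mapped by the right anchor to vectors
tangent to the orbits. -/
theorem exists_modelDeriv_tgt_eq {p : P} {z : Eucl k} (hz : modelDeriv k n B.left p z = 0) :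
    ∃ w : Eucl d', modelDeriv d' n' 𝒢'.src (𝒢'.unit (B.right p)) w = 0 ∧
      modelDeriv d' n' 𝒢'.tgt (𝒢'.unit (B.right p)) w = modelDeriv k n' B.right p z := by
  obtain ⟨σ, hσp, hσ, hσl⟩ := B.left_submersion.exists_localSection p
  obtain ⟨δ, hδ, h1, h2⟩ := B.right_principal
  have hl : ContMDiffAt (𝓡 k) (𝓡 n) ∞ B.left p := B.left_smooth.contMDiffAt
  have hσl' : ∀ᶠ q in 𝓝 p, B.left q = B.left (σ (B.left q)) := by
    filter_upwards [hl.continuousAt.eventually hσl] with q hq using hq.symm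
  have hs : ContMDiffAt (𝓡 k) (𝓡 k) ∞ (fun q => σ (B.left q)) p :=
    ContMDiffAt.comp p hσ.self_of_nhds hl
  -- The arrow from the right anchor of `σ (left q)` to that of `q`; it is a unit at `q = p`. Its
  -- target is `right q`, and its source factors through `left`, so the derivative of `h` sends `z`
  -- to the required vector.
  let h : P → G' := fun q => δ q (σ (B.left q))
  have hh : ContMDiffAt (𝓡 k) (𝓡 d') ∞ h p :=
    hδ.comp_contMDiffAt_of_eventually_mem (φ := fun q => (q, σ (B.left q)))
      (contMDiffAt_id.prodMk hs) hσl'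
  have hp : h p = 𝒢'.unit (B.right p) := by
    have := h2 p (𝒢'.unit (B.right p)) (𝒢'.tgt_unit _).symm
    rw [B.ract_unit] at this
    simp only [h, hσp, this]
  have ht : (fun q => 𝒢'.tgt (h q)) =ᶠ[𝓝 p] B.right := by
    filter_upwards [hσl'] with q hq using (h1 _ _ hq).1.symm
  have hs' : (fun q => 𝒢'.src (h q)) =ᶠ[𝓝 p] fun q => B.right (σ (B.left q)) := by
    filter_upwards [hσl'] with q hq
    rw [← B.right_ract _ _ (h1 _ _ hq).1, (h1 _ _ hq).2]
  refine ⟨modelDeriv k d' h p z, ?_, ?_⟩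
  · have h3 := modelDeriv_comp hp 𝒢'.src_smooth.contMDiffAt hh
    have h4 := modelDeriv_comp (g := fun y => B.right (σ y)) (f := B.left) (x := p) rfl
      (B.right_smooth.contMDiffAt.comp _ hσ.self_of_nhds) hl
    rw [modelDeriv_congr hs', h4] at h3
    have h5 := DFunLike.congr_fun h3 z
    simp only [ContinuousLinearMap.comp_apply, hz, map_zero] at h5
    exact h5.symm
  · have h3 := modelDeriv_comp hp 𝒢'.tgt_smooth.contMDiffAt hh
    rw [modelDeriv_congr ht] at h3
    exact (DFunLike.congr_fun h3 z).symm

/-- Vectors tangent to the orbits of `𝒢` lift to vectors tangent to the fibres of the right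
anchor. -/
theorem exists_modelDeriv_left_eq {p : P} {w : Eucl d}
    (hw : modelDeriv d n 𝒢.src (𝒢.unit (B.left p)) w = 0) :
    ∃ u : Eucl k, modelDeriv k n' B.right p u = 0 ∧
      modelDeriv k n B.left p u = modelDeriv d n 𝒢.tgt (𝒢.unit (B.left p)) w := by
  obtain ⟨σ, hσp, hσ, hσl⟩ := B.left_submersion.exists_localSection p
  set e := 𝒢.unit (B.left p)
  have he : 𝒢.src e = B.left p := 𝒢.src_unit _
  have hse : ContMDiffAt (𝓡 d) (𝓡 n) ∞ 𝒢.src e := 𝒢.src_smooth.contMDiffAt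
  have hev : ∀ᶠ g in 𝓝 e, 𝒢.src g = B.left (σ (𝒢.src g)) := by
    have h1 := hse.continuousAt
    rw [ContinuousAt, he] at h1
    filter_upwards [h1.eventually hσl] with g hg using hg.symm
  have hs : ContMDiffAt (𝓡 d) (𝓡 k) ∞ (fun g => σ (𝒢.src g)) e :=
    ContMDiffAt.comp_of_eq hσ.self_of_nhds hse he
  -- Here `left ∘ m = tgt` and `right ∘ m` factors through `src`, so the derivative of `m` at the
  -- unit sends `w` to the required lift.
  let m : G → P := fun g => B.lact g (σ (𝒢.src g))
  have hm : ContMDiffAt (𝓡 d) (𝓡 k) ∞ m e :=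
    B.lact_smooth.comp_contMDiffAt_of_eventually_mem (φ := fun g => (g, σ (𝒢.src g)))
      (contMDiffAt_id.prodMk hs) hev
  have hme : m e = p := by
    simp only [m, he, hσp]
    exact B.unit_lact p
  have hl : (fun g => B.left (m g)) =ᶠ[𝓝 e] 𝒢.tgt := by
    filter_upwards [hev] with g hg using B.left_lact _ _ hg
  have hr : (fun g => B.right (m g)) =ᶠ[𝓝 e] fun g => B.right (σ (𝒢.src g)) := by
    filter_upwards [hev] with g hg using B.right_lact _ _ hg
  refine ⟨modelDeriv d k m e w, ?_, ?_⟩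
  · have h3 := modelDeriv_comp hme B.right_smooth.contMDiffAt hm
    have h4 := modelDeriv_comp (g := fun y => B.right (σ y)) he
      (B.right_smooth.contMDiffAt.comp _ hσ.self_of_nhds) hse
    rw [modelDeriv_congr hr, h4] at h3
    have h5 := DFunLike.congr_fun h3 w
    simp only [ContinuousLinearMap.comp_apply, hw, map_zero] at h5
    exact h5.symm
  · have h3 := modelDeriv_comp hme B.left_smooth.contMDiffAt hm
    rw [modelDeriv_congr hl] at h3
    exact (DFunLike.congr_fun h3 w).symm

/-- Choose `u` killed by the derivative of `right` with the same image as `v` under that of `left`.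
Then `v - u` is tangent to a fibre of `left`, and its image under the derivative of `right` is that
of `v`. -/
theorem modelDeriv_right_mem_orbitTangent {p : P} {v : Eucl k}
    (h : (show TangentSpace (𝓡 n) (B.left p) from modelDeriv k n B.left p v) ∈
      𝒢.orbitTangent (B.left p)) :
    (show TangentSpace (𝓡 n') (B.right p) from modelDeriv k n' B.right p v) ∈
      𝒢'.orbitTangent (B.right p) := by
  rw [LieGroupoid.mem_orbitTangent_iff] at h ⊢
  obtain ⟨w, hw, hwv⟩ := h
  obtain ⟨u, hu, hul⟩ := B.exists_modelDeriv_left_eq hw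
  obtain ⟨w', hw', hw't⟩ := B.exists_modelDeriv_tgt_eq (p := p) (z := v - u)
    (by rw [map_sub, hul, hwv, sub_self])
  exact ⟨w', hw', by rw [hw't, map_sub, hu, sub_zero]⟩

theorem modelDeriv_mem_orbitTangent_iff (p : P) (v : Eucl k) :
    (show TangentSpace (𝓡 n) (B.left p) from modelDeriv k n B.left p v) ∈
      𝒢.orbitTangent (B.left p) ↔
    (show TangentSpace (𝓡 n') (B.right p) from modelDeriv k n' B.right p v) ∈
      𝒢'.orbitTangent (B.right p) :=
  ⟨B.modelDeriv_right_mem_orbitTangent, B.symm.modelDeriv_right_mem_orbitTangent⟩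

section Related

variable {B} {α : OneForm n M} {α' : OneForm n' M'}

theorem Related.right_eq_zero (h : B.Related α α') {p : P} (h0 : α (B.left p) = 0) :
    α' (B.right p) = 0 := by
  have h1 := h p
  unfold OneForm.pullbackAt at h1
  rw [h0] at h1
  refine ContinuousLinearMap.ext fun v => ?_
  obtain ⟨u, rfl⟩ := B.right_submersion.modelDeriv_surjective p v
  have h2 := DFunLike.congr_fun h1 u
  exact h2.symm

theorem Related.eq_zero_iff (h : B.Related α α') (p : P) :
    α (B.left p) = 0 ↔ α' (B.right p) = 0 :=
  ⟨h.right_eq_zero, h.symm.right_eq_zero⟩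

theorem Related.unique {η : OneForm n M} (hη : B.Related η α') (h : B.Related α α') : η = α := by
  refine ContMDiffSection.ext fun x => ?_
  obtain ⟨p, rfl⟩ := B.left_surjective x
  refine ContinuousLinearMap.ext fun v => ?_
  obtain ⟨u, rfl⟩ := B.left_submersion.modelDeriv_surjective p v
  exact DFunLike.congr_fun ((hη p).trans (h p).symm) u

theorem Related.isNondegenerateCriticalOrbit (h : B.Related α α') {p : P}
    (hnd : 𝒢'.IsNondegenerateCriticalOrbit α' (B.right p)) :
    𝒢.IsNondegenerateCriticalOrbit α (B.left p) := by
  classical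
  obtain ⟨h0', U', hU', hOU', f', hf', hbas', hdf', hhess'⟩ := hnd
  refine ⟨(h.eq_zero_iff p).2 h0', ?_⟩
  obtain ⟨δ, -, hδ, -⟩ := B.right_principal
  let U : Set M := B.left '' (B.right ⁻¹' U')
  -- The descent of `f'`, with value `0` off `U`. The choice of `q` is harmless: two choices differ
  -- by an arrow of `G'` with both ends in `U'`, and `f'` is basic there.
  let f : M → ℝ := fun x =>
    if hx : ∃ q, B.left q = x ∧ B.right q ∈ U' then f' (B.right hx.choose) else 0
  have hV : IsOpen (B.right ⁻¹' U') := hU'.preimage B.right_smooth.continuous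
  have hf : ∀ q, B.right q ∈ U' → f (B.left q) = f' (B.right q) := by
    intro q hq
    have hx : ∃ q', B.left q' = B.left q ∧ B.right q' ∈ U' := ⟨q, rfl, hq⟩
    have hfx : f (B.left q) = f' (B.right hx.choose) := dif_pos hx
    obtain ⟨h1, h2⟩ := hδ _ _ hx.choose_spec.1
    have h3 := B.right_ract _ _ h1
    rw [h2] at h3
    rw [hfx, h1, h3]
    exact (hbas' _ (h3 ▸ hq) (h1 ▸ hx.choose_spec.2)).symm
  have hfev : ∀ q, B.right q ∈ U' →
      (fun q => f (B.left q)) =ᶠ[𝓝 q] fun q => f' (B.right q) := fun q hq => by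
    filter_upwards [hV.mem_nhds hq] with q' hq' using hf q' hq'
  have hsec : ∀ q, B.right q ∈ U' → ∃ σ : M → P, σ (B.left q) = q ∧
      ContMDiffAt (𝓡 n) (𝓡 k) ∞ σ (B.left q) ∧
      ∀ᶠ y in 𝓝 (B.left q), B.left (σ y) = y ∧ B.right (σ y) ∈ U' := by
    intro q hq
    obtain ⟨σ, hσq, hσ, hσl⟩ := B.left_submersion.exists_localSection q
    refine ⟨σ, hσq, hσ.self_of_nhds, hσl.and ?_⟩
    exact hσ.self_of_nhds.continuousAt.preimage_mem_nhds (hV.mem_nhds (by rwa [hσq]))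
  have hUo : IsOpen U := by
    rw [isOpen_iff_mem_nhds]
    rintro _ ⟨q, hq, rfl⟩
    obtain ⟨σ, -, -, hσ⟩ := hsec q hq
    filter_upwards [hσ] with y hy using ⟨σ y, hy.2, hy.1⟩
  have hfs : ∀ x ∈ U, ContMDiffAt (𝓡 n) 𝓘(ℝ, ℝ) ∞ f x := by
    rintro _ ⟨q, hq, rfl⟩
    obtain ⟨σ, hσq, hσs, hσ⟩ := hsec q hq
    have h1 : ContMDiffAt (𝓡 n') 𝓘(ℝ, ℝ) ∞ f' (B.right q) := hf'.contMDiffAt (hU'.mem_nhds hq)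
    have h2 : ContMDiffAt (𝓡 n) 𝓘(ℝ, ℝ) ∞ (fun y => f' (B.right (σ y))) (B.left q) :=
      ContMDiffAt.comp_of_eq h1 (B.right_smooth.contMDiffAt.comp _ hσs) (by rw [hσq])
    refine h2.congr_of_eventuallyEq ?_
    filter_upwards [hσ] with y hy
    rw [← hf _ hy.2, hy.1]
  have hdf : ∀ x ∈ U, α x = mvfderiv (𝓡 n) f x := by
    rintro _ ⟨q, hq, rfl⟩
    have h1 : ContMDiffAt (𝓡 n') 𝓘(ℝ, ℝ) ∞ f' (B.right q) := hf'.contMDiffAt (hU'.mem_nhds hq)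
    have c1 := mfderiv_comp q ((hfs _ ⟨q, hq, rfl⟩).mdifferentiableAt (by simp))
      (B.left_smooth.mdifferentiable (by simp) q)
    have c2 := mfderiv_comp q (h1.mdifferentiableAt (by simp))
      (B.right_smooth.mdifferentiable (by simp) q)
    have c3 := (hfev q hq).mfderiv_eq (I := 𝓡 k) (I' := 𝓘(ℝ, ℝ))
    have c4 := hdf' _ hq
    refine ContinuousLinearMap.ext fun v => ?_
    obtain ⟨u, rfl⟩ := B.left_submersion.modelDeriv_surjective q v
    have d0 : α (B.left q) (modelDeriv k n B.left q u) =
      α' (B.right q) (modelDeriv k n' B.right q u) := DFunLike.congr_fun (h q) u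
    have d1 := DFunLike.congr_fun c1 u
    have d2 := DFunLike.congr_fun c2 u
    have d3 := DFunLike.congr_fun c3 u
    have d4 := DFunLike.congr_fun c4 (modelDeriv k n' B.right q u)
    exact d0.trans (d4.trans (d2.symm.trans (d3.symm.trans d1)))
  refine ⟨U, hUo, ?_, f, fun x hx => (hfs x hx).contMDiffWithinAt, ?_, hdf, ?_⟩
  · rintro _ ⟨g, hg, rfl⟩
    refine ⟨B.lact g p, ?_, B.left_lact _ _ hg⟩
    rw [Set.mem_preimage, B.right_lact _ _ hg]
    exact hOU' ⟨𝒢'.unit _, 𝒢'.src_unit _, 𝒢'.tgt_unit _⟩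
  · rintro g ⟨q, hq, hqg⟩ -
    have hq' : B.right (B.lact g q) = B.right q := B.right_lact _ _ hqg.symm
    rw [← hqg, ← B.left_lact _ _ hqg.symm, hf _ hq, hf _ (by rw [hq']; exact hq), hq']
  · rintro _ ⟨g, hg, rfl⟩ v
    -- Every point of the orbit of `left p` is the left anchor of a point `q = g p` over the same
    -- `right p`, so the Hessian comparison can be made at `q`.
    obtain ⟨q, hql, hqr⟩ : ∃ q, B.left q = 𝒢.tgt g ∧ B.right q = B.right p :=
      ⟨B.lact g p, B.left_lact _ _ hg, B.right_lact _ _ hg⟩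
    revert v
    rw [← hql]
    intro v
    have hO : B.right p ∈ 𝒢'.orbit (B.right p) := ⟨𝒢'.unit _, 𝒢'.src_unit _, 𝒢'.tgt_unit _⟩
    have hq : B.right q ∈ U' := by
      rw [hqr]
      exact hOU' hO
    have hz' : α' (B.right q) = 0 := by
      rw [hqr]
      exact h0'
    have hz : α (B.left q) = 0 := (h.eq_zero_iff q).2 hz'
    have e1 := modelHessian_comp B.left_smooth (hfs _ ⟨q, hq, rfl⟩)
      ((hdf _ ⟨q, hq, rfl⟩).symm.trans hz)
    have e2 := modelHessian_comp B.right_smooth (hf'.contMDiffAt (hU'.mem_nhds hq))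
      ((hdf' _ hq).symm.trans hz')
    have e3 : ∀ a b : Eucl k, modelHessian (n := k) (fun q => f (B.left q)) q a b =
        modelHessian (n := k) (fun q => f' (B.right q)) q a b := fun a b => by
      unfold modelHessian
      rw [hessianAt_congr (hfev q hq)]
    -- With `v` lifted to `u` in `T_q P`, both kernel conditions say that `u` is in the kernel of
    -- the common pulled-back Hessian: every test vector on either side lifts to `T_q P` too.
    obtain ⟨u, rfl⟩ := B.left_submersion.modelDeriv_surjective q v
    refine Iff.trans ?_ (B.modelDeriv_mem_orbitTangent_iff q u).symm
    refine Iff.trans ?_ (hhess' (B.right q) (by rw [hqr]; exact hO) _)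
    constructor
    · intro H w
      obtain ⟨b, rfl⟩ := B.right_submersion.modelDeriv_surjective q w
      exact (e2 u b).symm.trans ((e3 u b).symm.trans ((e1 u b).trans (H _)))
    · intro H w
      obtain ⟨b, rfl⟩ := B.left_submersion.modelDeriv_surjective q w
      exact (e1 u b).symm.trans ((e3 u b).trans ((e2 u b).trans (H _)))

theorem Related.isMorseClosedBasic (h : B.Related α α')
    (hloc : ∀ x, ∃ b : M → M', OneForm.IsLocalPullbackAt (fun y => α y) α' b x)
    (hα' : 𝒢'.IsMorseClosedBasic α') : 𝒢.IsMorseClosedBasic α where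
  closed := hα'.closed.of_isLocalPullbackAt hloc
  basic := h.isBasic
  nondegenerate x hx := by
    obtain ⟨p, rfl⟩ := B.left_surjective x
    exact h.isNondegenerateCriticalOrbit (hα'.nondegenerate _ (h.right_eq_zero hx))

end Related

end PrincipalBibundle

end

theorem mainTheorem8 {n d n' d' : ℕ}
    {M : Type u₁} {G : Type u₂} {M' : Type u₃} {G' : Type u₄}
    [TopologicalSpace M] [ChartedSpace (Eucl n) M] [IsManifold (𝓡 n) ∞ M]
    [TopologicalSpace G] [ChartedSpace (Eucl d) G] [IsManifold (𝓡 d) ∞ G]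
    [TopologicalSpace M'] [ChartedSpace (Eucl n') M'] [IsManifold (𝓡 n') ∞ M']
    [TopologicalSpace G'] [ChartedSpace (Eucl d') G'] [IsManifold (𝓡 d') ∞ G']
    (𝒢 : LieGroupoid n d M G) (𝒢' : LieGroupoid n' d' M' G') :
    (MoritaEquivalent.{w, u₁, u₂, u₃, u₄} 𝒢 𝒢' →
      (∃ α' : OneForm n' M', 𝒢'.IsMorseClosedBasic α') →
        ∃ α : OneForm n M, 𝒢.IsMorseClosedBasic α) ∧
    (∀ (k : ℕ) (P : Type w) [TopologicalSpace P] [ChartedSpace (Eucl k) P]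
      [IsManifold (𝓡 k) ∞ P] (B : PrincipalBibundle 𝒢 𝒢' k P) (α' : OneForm n' M'),
      𝒢'.IsMorseClosedBasic α' →
      ∃ α : OneForm n M,
        (∀ p : P, α.pullbackAt k B.left p = α'.pullbackAt k B.right p) ∧
        (∀ η : OneForm n M,
          (∀ p : P, η.pullbackAt k B.left p = α'.pullbackAt k B.right p) → η = α) ∧
        𝒢.IsMorseClosedBasic α ∧
        (∀ p : P, B.left ⁻¹' 𝒢.orbit (B.left p) = B.right ⁻¹' 𝒢'.orbit (B.right p)) ∧
        (∀ p : P, α (B.left p) = 0 ↔ α' (B.right p) = 0) ∧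
        (∀ p : P, 𝒢.IsNondegenerateCriticalOrbit α (B.left p) ↔
          𝒢'.IsNondegenerateCriticalOrbit α' (B.right p))) := by
  refine ⟨?_, ?_⟩
  · rintro ⟨k, P, _, _, _, ⟨B⟩⟩ ⟨α', hα'⟩
    obtain ⟨α, hα, hloc⟩ := B.exists_related hα'.basic
    exact ⟨α, hα.isMorseClosedBasic hloc hα'⟩
  · intro k P _ _ _ B α' hα'
    obtain ⟨α, hα, hloc⟩ := B.exists_related hα'.basic
    exact ⟨α, hα, fun η hη => PrincipalBibundle.Related.unique hη hα,
      hα.isMorseClosedBasic hloc hα', B.preimage_orbit_eq, hα.eq_zero_iff,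
      fun p => ⟨hα.symm.isNondegenerateCriticalOrbit, hα.isNondegenerateCriticalOrbit⟩⟩
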